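/- Consider a network with a source $S$, a destination $D$ and $N\ge 1$ relays $R_1,\dots,R_N$. Each of the $2N$ links $AB\in\{SR_b,R_bD : 1\le b\le N\}$ has a path loss $\bar h_{AB}>0$, a share $\rho_{AB}>0$ of the optical power, and a random fading gain $\tilde h_{AB}$; the $2N$ gains are mutually independent, and $\tilde h_{AB}$ has the Gamma-Gamma density $$f(x)=\frac{2(\alpha\beta)^{(\alpha+\beta)/2}}{\Gamma(\alpha)\Gamma(\beta)}\,x^{\frac{\alpha+\beta}{2}-1}K_{\alpha-\beta}\bigl(2\sqrt{\alpha\beta x}\bigr),\qquad x>0,$$ where $\alpha=\alpha_{AB}>0$, $\beta=\beta_{AB}>0$, $\alpha_{AB}-\beta_{AB}\notin\mathbb Z$, and $K_\nu$ is the modified Bessel function of the second kind. The link has signal-to-noise ratio $\gamma_{AB}=\eta^2T_b^2\rho_{AB}^2P_t^2(\bar h_{AB}\tilde h_{AB})^2/N_0$, where $\eta,T_b,P_t,N_0>0$ do not depend on the link. The select-max protocol activates a relay $R_b$ for which $\min(\gamma_{SR_b},\gamma_{R_bD})$ is largest (ties broken arbitrarily), and an outage occurs if $\gamma_{SR_b}<\gamma_{th}$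 or $\gamma_{R_bD}<\gamma_{th}$ for the activated relay $R_b$, where $\gamma_{th}>0$ is a threshold common to all links. Let $P_{out}$ be the probability of outage and let $P_M=\eta T_bP_t/\sqrt{N_0\gamma_{th}}$ be the power margin. Then, with $\alpha_{AB},\beta_{AB},\bar h_{AB},\rho_{AB}$ fixed and $P_M\to\infty$ (in whatever way $\eta,T_b,P_t,N_0,\gamma_{th}$ vary), $$P_{out}\sim\prod_{b=1}^{N}\left(\frac{\Gamma(p_{SR_b}-q_{SR_b})}{q_{SR_b}\Gamma(\alpha_{SR_b})\Gamma(\beta_{SR_b})}\left(\frac{\alpha_{SR_b}\beta_{SR_b}}{\bar h_{SR_b}\rho_{SR_b}P_M}\right)^{q_{SR_b}}+\frac{\Gamma(p_{R_bD}-q_{R_bD})}{q_{R_bD}\Gamma(\alpha_{R_bD})\Gamma(\beta_{R_bD})}\left(\frac{\alpha_{R_bD}\beta_{R_bD}}{\bar h_{R_bD}\rho_{R_bD}P_M}\right)^{q_{R_bD}}\right),$$ that is, the ratio of the two sides tends to $1$, where $p_{AB}=\max(\alpha_{AB},\beta_{AB})$ and $q_{AB}=\min(\alpha_{AB},\beta_{AB})$.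 -/

import Mathlib

open MeasureTheory ProbabilityTheory Filter Asymptotics

noncomputable section

namespace FSO

/-- The modified Bessel function of the second kind `K_ν(z)`, for real order `ν` and real `z > 0`:
`K_ν(z) = (1/2) (z/2)^ν ∫_0^∞ t^(-ν-1) exp(-t - z²/(4t)) dt`. -/
def besselK (ν z : ℝ) : ℝ :=
  1 / 2 * (z / 2) ^ ν *
    ∫ t in Set.Ioi (0 : ℝ), t ^ (-ν - 1) * Real.exp (-t - z ^ 2 / (4 * t))

/-- The Gamma-Gamma probability density with parameters `α, β > 0`, supported on `(0, ∞)`. -/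
def gammaGammaPDF (α β x : ℝ) : ℝ :=
  if 0 < x then
    2 * (α * β) ^ ((α + β) / 2) / (Real.Gamma α * Real.Gamma β) *
      x ^ ((α + β) / 2 - 1) * besselK (α - β) (2 * Real.sqrt (α * β * x))
  else 0

/-- The Gamma-Gamma distribution. -/
def gammaGammaMeasure (α β : ℝ) : Measure ℝ :=
  volume.withDensity fun x => ENNReal.ofReal (gammaGammaPDF α β x)

/-- The `2N` links of a network with one source, one destination and `N` relays. -/
abbrev Link (N : ℕ) : Type := Fin N ⊕ Fin N

/-- The link from the source to the relay `R_b`. -/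
abbrev Link.SR {N : ℕ} (b : Fin N) : Link N := Sum.inl b

/-- The link from the relay `R_b` to the destination. -/
abbrev Link.RD {N : ℕ} (b : Fin N) : Link N := Sum.inr b

/-- The parameters shared by all links. -/
structure SystemParams where
  /-- responsivity `η` of the photodetectors -/
  responsivity : ℝ
  /-- duration `T_b` of a slot -/
  slotDuration : ℝ
  /-- total optical power `P_t` -/
  power : ℝ
  /-- noise level `N₀` -/
  noise : ℝ
  /-- threshold SNR `γ_th` -/
  threshold : ℝ
  responsivity_pos : 0 < responsivity
  slotDuration_pos : 0 < slotDuration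
  power_pos : 0 < power
  noise_pos : 0 < noise
  threshold_pos : 0 < threshold

/-- The power margin `P_M = η T_b P_t / √(N₀ γ_th)`. -/
def SystemParams.powerMargin (s : SystemParams) : ℝ :=
  s.responsivity * s.slotDuration * s.power / Real.sqrt (s.noise * s.threshold)

/-- The instantaneous SNR `η² ρ² T_b² P_t² h² / N₀` of a link with power fraction `ρ` and channel
gain `h`. -/
def SystemParams.snr (s : SystemParams) (ρ h : ℝ) : ℝ :=
  s.responsivity ^ 2 * ρ ^ 2 * s.slotDuration ^ 2 * s.power ^ 2 * h ^ 2 / s.noise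

section Protocol

variable {N : ℕ} {Ω : Type*}

/-- The instantaneous SNR of a link, whose channel gain is the product of the path loss `hbar` and
the turbulence-induced fading `h`. -/
def linkSNR (s : SystemParams) (ρ hbar : Link N → ℝ) (h : Link N → Ω → ℝ)
    (l : Link N) (ω : Ω) : ℝ :=
  s.snr (ρ l) (hbar l * h l ω)

/-- The min equivalent SNR of the path through the relay `R_i`. -/
def pathSNR (s : SystemParams) (ρ hbar : Link N → ℝ) (h : Link N → Ω → ℝ)
    (i : Fin N) (ω : Ω) : ℝ :=
  min (linkSNR s ρ hbar h (Link.SR i) ω) (linkSNR s ρ hbar h (Link.RD i) ω)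

/-- `b` is a select-max rule: in every channel state it activates a relay that maximizes the
min equivalent SNR (ties may be broken in any way). -/
def IsSelectMax (s : SystemParams) (ρ hbar : Link N → ℝ) (h : Link N → Ω → ℝ)
    (b : Ω → Fin N) : Prop :=
  ∀ ω i, pathSNR s ρ hbar h i ω ≤ pathSNR s ρ hbar h (b ω) ω

/-- The outage event when the relay `b ω` is activated in the channel state `ω`: the SNR of one of
the two links in use is below the threshold. -/
def outageEvent (s : SystemParams) (ρ hbar : Link N → ℝ) (h : Link N → Ω → ℝ)
    (b : Ω → Fin N) : Set Ω :=
  {ω | linkSNR s ρ hbar h (Link.SR (b ω)) ω < s.threshold ∨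
    linkSNR s ρ hbar h (Link.RD (b ω)) ω < s.threshold}

end Protocol

/-- The leading term `Γ(p-q) / (q Γ(α) Γ(β)) · (α β / (hbar ρ P))^q` of the outage probability of
one link, where `p = max α β` and `q = min α β`. -/
def leadingTerm (α β hbar ρ P : ℝ) : ℝ :=
  Real.Gamma (max α β - min α β) / (min α β * Real.Gamma α * Real.Gamma β) *
    (α * β / (hbar * ρ * P)) ^ min α β

end FSO

end

/-!
# Outage of select-max relaying over Gamma-Gamma fading

Select-max picks the relay with the best weaker link, so it is in outage exactly when every relay
has a link below the threshold (`FSO.outageEvent_eq_iInter`). The gains are independent, hence the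
outage probability is `∏ r, (p_SR + p_RD - p_SR * p_RD)` with `p_l` the probability that the link
`l` is below the threshold (`FSO.measureReal_outageEvent`), and a link is below the threshold
precisely when its gain lies in the interval of radius `1 / (hbar * ρ * P_M)` around `0`.

It remains to find the mass that the Gamma-Gamma law gives to a small interval `(0, x)`. Inserting
the integral representation of `K_ν` and using the symmetry `K_{-ν} = K_ν`, in the form of
`FSO.dampedGamma_neg`, the density is exactly `C u^(q-1) J(α β u)`, where `q = min α β`,
`p = max α β`, `C` is a constant and `J(c) = ∫_0^∞ t^(p-q-1) exp(-t - c/t) dt`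
(`FSO.gammaGammaPDF_eq_min_max`). The function `J` decreases, and `J(c) → Γ(p - q)` as `c → 0` by
dominated convergence. So the mass of `(0, x)` lies between `J(α β x) C x^q / q` and
`Γ(p - q) C x^q / q`, whose ratio tends to `1`: the leading term of each link. The products
`p_SR * p_RD` are negligible against the sums because the leading terms tend to `0`, and asymptotic
equivalence is preserved by finite products.
-/

namespace FSO

open Set Topology

/-! ### A damped Gamma integral -/

/-- The integral `∫_0^∞ t^(s-1) exp(-t - c/t) dt`. It is `Γ(s)` at `c = 0`, and for `c > 0` it is
`2 c^(s/2) K_s(2√c)`. -/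
noncomputable def dampedGamma (s c : ℝ) : ℝ :=
  ∫ t in Ioi (0 : ℝ), t ^ (s - 1) * Real.exp (-t - c / t)

lemma integrableOn_rpow_mul_exp_neg {s : ℝ} (hs : 0 < s) :
    IntegrableOn (fun t : ℝ => t ^ (s - 1) * Real.exp (-t)) (Ioi 0) := by
  simpa only [mul_comm] using Real.GammaIntegral_convergent hs

lemma measurable_dampedGamma_integrand (s c : ℝ) :
    Measurable fun t : ℝ => t ^ (s - 1) * Real.exp (-t - c / t) := by
  fun_prop

lemma norm_dampedGamma_integrand_le (s : ℝ) {c t : ℝ} (hc : 0 ≤ c) (ht : 0 < t) :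
    ‖t ^ (s - 1) * Real.exp (-t - c / t)‖ ≤ t ^ (s - 1) * Real.exp (-t) := by
  have : 0 ≤ c / t := by positivity
  rw [Real.norm_of_nonneg (by positivity)]
  gcongr
  linarith

lemma integrableOn_dampedGamma {s c : ℝ} (hs : 0 < s) (hc : 0 ≤ c) :
    IntegrableOn (fun t : ℝ => t ^ (s - 1) * Real.exp (-t - c / t)) (Ioi 0) := by
  refine (integrableOn_rpow_mul_exp_neg hs).mono'
    (measurable_dampedGamma_integrand s c).aestronglyMeasurable ?_
  filter_upwards [ae_restrict_mem measurableSet_Ioi] with t ht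
  exact norm_dampedGamma_integrand_le s hc ht

lemma dampedGamma_zero {s : ℝ} (hs : 0 < s) : dampedGamma s 0 = Real.Gamma s := by
  simp [dampedGamma, Real.Gamma_eq_integral hs, mul_comm]

lemma dampedGamma_nonneg (s c : ℝ) : 0 ≤ dampedGamma s c :=
  setIntegral_nonneg measurableSet_Ioi fun _ ht =>
    mul_nonneg (Real.rpow_nonneg (le_of_lt ht) _) (Real.exp_pos _).le

lemma dampedGamma_anti {s c d : ℝ} (hs : 0 < s) (hc : 0 ≤ c) (hcd : c ≤ d) :
    dampedGamma s d ≤ dampedGamma s c := by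
  refine setIntegral_mono_on (integrableOn_dampedGamma hs (hc.trans hcd))
    (integrableOn_dampedGamma hs hc) measurableSet_Ioi fun t (_ : 0 < t) => ?_
  gcongr

lemma dampedGamma_le_Gamma {s c : ℝ} (hs : 0 < s) (hc : 0 ≤ c) :
    dampedGamma s c ≤ Real.Gamma s :=
  dampedGamma_zero hs ▸ dampedGamma_anti hs le_rfl hc

lemma tendsto_dampedGamma {s : ℝ} (hs : 0 < s) :
    Tendsto (dampedGamma s) (𝓝[>] 0) (𝓝 (Real.Gamma s)) := by
  rw [← dampedGamma_zero hs]
  refine tendsto_integral_filter_of_dominated_convergence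
    (fun t : ℝ => t ^ (s - 1) * Real.exp (-t)) (Eventually.of_forall fun c =>
      (measurable_dampedGamma_integrand s c).aestronglyMeasurable) ?_
    (integrableOn_rpow_mul_exp_neg hs) ?_
  · filter_upwards [self_mem_nhdsWithin] with c hc
    filter_upwards [ae_restrict_mem measurableSet_Ioi] with t ht
    exact norm_dampedGamma_integrand_le s (le_of_lt hc) ht
  · refine Eventually.of_forall fun t => Tendsto.mono_left ?_ nhdsWithin_le_nhds
    have : Continuous fun c : ℝ => t ^ (s - 1) * Real.exp (-t - c / t) := by fun_prop
    exact this.tendsto 0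

/-- The reflection formula that underlies `K_{-s} = K_s`, by the substitution `t ↦ c / t`. -/
lemma dampedGamma_neg (s : ℝ) {c : ℝ} (hc : 0 < c) :
    dampedGamma (-s) c = c ^ (-s) * dampedGamma s c := by
  unfold dampedGamma
  set g : ℝ → ℝ := fun t => t ^ (-s - 1) * Real.exp (-t - c / t)
  have h1 : ∫ t in Ioi (0 : ℝ), g t = c * ∫ t in Ioi (0 : ℝ), g (c * t) := by
    simpa using (integral_comp_mul_left_Ioi' g 0 hc).symm
  have h2 := integral_comp_rpow_Ioi (fun t => g (c * t)) (p := -1) (by norm_num)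
  rw [h1, ← h2, ← integral_const_mul, ← integral_const_mul]
  refine setIntegral_congr_fun measurableSet_Ioi fun t ht => ?_
  have ht : 0 < t := ht
  simp only [g, smul_eq_mul, abs_neg, abs_one, one_mul, Real.rpow_neg_one]
  rw [Real.mul_rpow hc.le (by positivity), Real.inv_rpow ht.le, ← Real.rpow_neg ht.le]
  have e1 : -(c * t⁻¹) - c / (c * t⁻¹) = -t - c / t := by field_simp; ring
  have e2 : c ^ (-s) = c * c ^ (-s - 1) := by
    rw [Real.rpow_sub_one hc.ne']; field_simp
  have e3 : t ^ (s - 1) = t ^ (-1 - 1 : ℝ) * t ^ (-(-s - 1)) := by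
    rw [← Real.rpow_add ht]; ring_nf
  rw [e1, e2, e3]; ring

/-! ### The Gamma-Gamma law near the origin -/

lemma gammaGammaPDF_of_pos {α β x : ℝ} (hα : 0 < α) (hβ : 0 < β) (hx : 0 < x) :
    gammaGammaPDF α β x = (α * β) ^ α / (Real.Gamma α * Real.Gamma β) * x ^ (α - 1) *
      dampedGamma (β - α) (α * β * x) := by
  have hy : 0 < α * β := mul_pos hα hβ
  have hyx : 0 < α * β * x := mul_pos hy hx
  have e1 : (2 * Real.sqrt (α * β * x)) ^ 2 = 4 * (α * β * x) := by
    rw [mul_pow, Real.sq_sqrt hyx.le]; norm_num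
  have e2 : ∀ t : ℝ, 4 * (α * β * x) / (4 * t) = α * β * x / t := fun t =>
    mul_div_mul_left _ _ (by norm_num)
  have e3 : (2 * Real.sqrt (α * β * x) / 2) ^ (α - β) =
      (α * β) ^ ((α - β) / 2) * x ^ ((α - β) / 2) := by
    rw [mul_div_cancel_left₀ _ (by norm_num : (2 : ℝ) ≠ 0), Real.sqrt_eq_rpow,
      ← Real.rpow_mul hyx.le, Real.mul_rpow hy.le hx.le]
    ring_nf
  have e4 : (α * β) ^ α = (α * β) ^ ((α + β) / 2) * (α * β) ^ ((α - β) / 2) := by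
    rw [← Real.rpow_add hy]; ring_nf
  have e5 : x ^ (α - 1) = x ^ ((α + β) / 2 - 1) * x ^ ((α - β) / 2) := by
    rw [← Real.rpow_add hx]; ring_nf
  rw [gammaGammaPDF, if_pos hx, besselK, dampedGamma, e1, e3, e4, e5]
  simp only [e2, neg_sub]
  ring

/-- The Gamma-Gamma density as an exact power of `x` times a factor with a finite positive limit
at the origin. -/
lemma gammaGammaPDF_eq_min_max {α β x : ℝ} (hα : 0 < α) (hβ : 0 < β) (hx : 0 < x) :
    gammaGammaPDF α β x =
      (α * β) ^ min α β / (Real.Gamma α * Real.Gamma β) * x ^ (min α β - 1) *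
        dampedGamma (max α β - min α β) (α * β * x) := by
  rw [gammaGammaPDF_of_pos hα hβ hx]
  rcases le_total α β with h | h
  · rw [min_eq_left h, max_eq_right h]
  · have hy : 0 < α * β := mul_pos hα hβ
    rw [min_eq_right h, max_eq_left h, ← neg_sub α β, dampedGamma_neg _ (mul_pos hy hx),
      Real.mul_rpow hy.le hx.le]
    have e1 : (α * β) ^ β = (α * β) ^ α * (α * β) ^ (-(α - β)) := by
      rw [← Real.rpow_add hy]; ring_nf
    have e2 : x ^ (β - 1) = x ^ (α - 1) * x ^ (-(α - β)) := by
      rw [← Real.rpow_add hx]; ring_nf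
    rw [e1, e2]; ring

lemma setLIntegral_Ioo_rpow {q C x : ℝ} (hq : 0 < q) (hC : 0 ≤ C) (hx : 0 ≤ x) :
    ∫⁻ u in Ioo 0 x, ENNReal.ofReal (C * u ^ (q - 1)) = ENNReal.ofReal (C * (x ^ q / q)) := by
  rw [← ofReal_integral_eq_lintegral_ofReal]
  · rw [integral_const_mul, ← integral_Ioc_eq_integral_Ioo,
      ← intervalIntegral.integral_of_le hx, integral_rpow (Or.inl (by linarith))]
    simp [Real.zero_rpow hq.ne']
  · refine Integrable.const_mul ?_ C
    have := intervalIntegral.intervalIntegrable_rpow' (a := 0) (b := x) (r := q - 1) (by linarith)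
    exact ((intervalIntegrable_iff_integrableOn_Ioc_of_le hx).1 this).mono_set Ioo_subset_Ioc_self
  · filter_upwards [ae_restrict_mem measurableSet_Ioo] with u hu
    exact mul_nonneg hC (Real.rpow_nonneg hu.1.le _)

lemma gammaGammaMeasure_Ioo_neg (α β x : ℝ) :
    gammaGammaMeasure α β (Ioo (-x) x) =
      ∫⁻ u in Ioo 0 x, ENNReal.ofReal (gammaGammaPDF α β u) := by
  have h : (fun u => ENNReal.ofReal (gammaGammaPDF α β u)) =
      (Ioi 0).indicator fun u => ENNReal.ofReal (gammaGammaPDF α β u) := by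
    ext u
    by_cases hu : 0 < u <;> simp [gammaGammaPDF, hu]
  rw [gammaGammaMeasure, withDensity_apply _ measurableSet_Ioo, h,
    setLIntegral_indicator measurableSet_Ioi, ← h]
  congr 2
  ext u
  simp only [mem_inter_iff, mem_Ioi, mem_Ioo]
  constructor
  · rintro ⟨h0, -, h1⟩; exact ⟨h0, h1⟩
  · rintro ⟨h0, h1⟩; exact ⟨h0, by linarith, h1⟩

/-- Bounding the slowly varying factor of the density by its extreme values on `(0, x)` and
integrating the power of `x` exactly. -/
lemma gammaGammaMeasure_Ioo_bounds {α β x : ℝ} (hα : 0 < α) (hβ : 0 < β) (hαβ : α ≠ β)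
    (hx : 0 < x) :
    dampedGamma (max α β - min α β) (α * β * x) *
        ((α * β * x) ^ min α β / (min α β * Real.Gamma α * Real.Gamma β)) ≤
      (gammaGammaMeasure α β).real (Ioo (-x) x) ∧
    (gammaGammaMeasure α β).real (Ioo (-x) x) ≤ Real.Gamma (max α β - min α β) *
        ((α * β * x) ^ min α β / (min α β * Real.Gamma α * Real.Gamma β)) := by
  have hs : 0 < max α β - min α β := sub_pos.2 (min_lt_max.2 hαβ)
  have hq : 0 < min α β := lt_min hα hβ
  have hpdf := fun u (hu : 0 < u) => gammaGammaPDF_eq_min_max hα hβ hu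
  have hanti := fun u (hu : u ∈ Ioo 0 x) => dampedGamma_anti (s := max α β - min α β) hs
    (c := α * β * u) (d := α * β * x) (by have := hu.1; positivity)
    (by have := hu.2; gcongr)
  have hle := fun u (hu : u ∈ Ioo 0 x) => dampedGamma_le_Gamma (s := max α β - min α β) hs
    (c := α * β * u) (by have := hu.1; positivity)
  have hΓ := Real.Gamma_pos_of_pos hs
  have hJ := dampedGamma_nonneg (max α β - min α β) (α * β * x)
  have hΓα := Real.Gamma_pos_of_pos hα
  have hΓβ := Real.Gamma_pos_of_pos hβ
  generalize max α β - min α β = s at *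
  generalize min α β = q at *
  set K := (α * β) ^ q / (Real.Gamma α * Real.Gamma β) with hK
  have hK0 : 0 ≤ K := by positivity
  have key : ∀ D : ℝ, D * ((α * β * x) ^ q / (q * Real.Gamma α * Real.Gamma β)) =
      K * D * (x ^ q / q) := fun D => by
    rw [Real.mul_rpow (by positivity) hx.le, hK]; field_simp
  rw [key, key, measureReal_def, gammaGammaMeasure_Ioo_neg]
  have up : ∫⁻ u in Ioo 0 x, ENNReal.ofReal (gammaGammaPDF α β u) ≤
      ENNReal.ofReal (K * Real.Gamma s * (x ^ q / q)) := by
    rw [← setLIntegral_Ioo_rpow hq (by positivity) hx.le]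
    refine setLIntegral_mono' measurableSet_Ioo fun u hu => ENNReal.ofReal_le_ofReal ?_
    have := hu.1
    rw [hpdf u hu.1, mul_right_comm]
    have := hle u hu
    gcongr
  have low : ENNReal.ofReal (K * dampedGamma s (α * β * x) * (x ^ q / q)) ≤
      ∫⁻ u in Ioo 0 x, ENNReal.ofReal (gammaGammaPDF α β u) := by
    rw [← setLIntegral_Ioo_rpow hq (by positivity) hx.le]
    refine setLIntegral_mono' measurableSet_Ioo fun u hu => ENNReal.ofReal_le_ofReal ?_
    have := hu.1
    rw [hpdf u hu.1, mul_right_comm]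
    have := hanti u hu
    gcongr
  exact ⟨(ENNReal.ofReal_le_iff_le_toReal (up.trans_lt ENNReal.ofReal_lt_top).ne).1 low,
    ENNReal.toReal_le_of_le_ofReal (by positivity) up⟩

lemma gammaGammaMeasure_Ioo_isEquivalent {α β : ℝ} (hα : 0 < α) (hβ : 0 < β) (hαβ : α ≠ β) :
    (fun x => (gammaGammaMeasure α β).real (Ioo (-x) x)) ~[𝓝[>] 0]
      fun x => Real.Gamma (max α β - min α β) *
        ((α * β * x) ^ min α β / (min α β * Real.Gamma α * Real.Gamma β)) := by
  have hs : 0 < max α β - min α β := sub_pos.2 (min_lt_max.2 hαβ)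
  have hq : 0 < min α β := lt_min hα hβ
  have hΓ := Real.Gamma_pos_of_pos hs
  have hΓα := Real.Gamma_pos_of_pos hα
  have hΓβ := Real.Gamma_pos_of_pos hβ
  have hden : ∀ x : ℝ, 0 < x →
      0 < (α * β * x) ^ min α β / (min α β * Real.Gamma α * Real.Gamma β) :=
    fun x hx => by positivity
  refine isEquivalent_of_tendsto_one ?_
  have hmul : Tendsto (fun x : ℝ => α * β * x) (𝓝[>] 0) (𝓝[>] 0) := by
    refine tendsto_nhdsWithin_iff.2 ⟨?_, ?_⟩
    · have : Continuous fun x : ℝ => α * β * x := by fun_prop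
      simpa using (this.tendsto 0).mono_left nhdsWithin_le_nhds
    · filter_upwards [self_mem_nhdsWithin] with x hx
      exact mul_pos (mul_pos hα hβ) hx
  have hlow : Tendsto (fun x => dampedGamma (max α β - min α β) (α * β * x) /
      Real.Gamma (max α β - min α β)) (𝓝[>] 0) (𝓝 1) := by
    simpa [hΓ.ne'] using ((tendsto_dampedGamma hs).comp hmul).div_const
      (Real.Gamma (max α β - min α β))
  refine tendsto_of_tendsto_of_tendsto_of_le_of_le' hlow tendsto_const_nhds ?_ ?_
  · filter_upwards [self_mem_nhdsWithin] with x hx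
    have := (gammaGammaMeasure_Ioo_bounds hα hβ hαβ hx).1
    rw [Pi.div_apply, div_le_div_iff₀ hΓ (mul_pos hΓ (hden x hx))]
    nlinarith
  · filter_upwards [self_mem_nhdsWithin] with x hx
    exact div_le_one_of_le₀ (gammaGammaMeasure_Ioo_bounds hα hβ hαβ hx).2
      (mul_pos hΓ (hden x hx)).le

/-- For `P → ∞`, a link whose fading gain has a Gamma-Gamma law is in outage with probability
asymptotic to its leading term. -/
lemma gammaGammaMeasure_isEquivalent_leadingTerm {α β hbar ρ : ℝ} (hα : 0 < α) (hβ : 0 < β)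
    (hαβ : α ≠ β) (hhbar : 0 < hbar) (hρ : 0 < ρ) :
    (fun P : ℝ => (gammaGammaMeasure α β).real (Ioo (-(hbar * ρ * P)⁻¹) (hbar * ρ * P)⁻¹)) ~[atTop]
      leadingTerm α β hbar ρ := by
  have hlim : Tendsto (fun P : ℝ => (hbar * ρ * P)⁻¹) atTop (𝓝[>] 0) :=
    tendsto_inv_atTop_nhdsGT_zero.comp (tendsto_id.const_mul_atTop (mul_pos hhbar hρ))
  refine ((gammaGammaMeasure_Ioo_isEquivalent hα hβ hαβ).comp_tendsto hlim).congr_right ?_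
  refine Eventually.of_forall fun P => ?_
  simp only [Function.comp_apply, leadingTerm, div_eq_mul_inv]
  ring

lemma leadingTerm_nonneg {α β hbar ρ P : ℝ} (hα : 0 < α) (hβ : 0 < β) (hhbar : 0 < hbar)
    (hρ : 0 < ρ) (hP : 0 < P) : 0 ≤ leadingTerm α β hbar ρ P := by
  have hΓ := Real.Gamma_nonneg_of_nonneg (sub_nonneg.2 (min_le_max (a := α) (b := β)))
  have hq : 0 < min α β := lt_min hα hβ
  have hΓα := Real.Gamma_pos_of_pos hα
  have hΓβ := Real.Gamma_pos_of_pos hβ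
  unfold leadingTerm
  positivity

lemma tendsto_leadingTerm_atTop {α β hbar ρ : ℝ} (hα : 0 < α) (hβ : 0 < β) (hhbar : 0 < hbar)
    (hρ : 0 < ρ) : Tendsto (leadingTerm α β hbar ρ) atTop (𝓝 0) := by
  have hq : 0 < min α β := lt_min hα hβ
  have h1 : Tendsto (fun P : ℝ => α * β / (hbar * ρ * P)) atTop (𝓝 0) :=
    (tendsto_id.const_mul_atTop (mul_pos hhbar hρ)).const_div_atTop _
  have h2 := h1.rpow_const (Or.inr hq.le)
  rw [Real.zero_rpow hq.ne'] at h2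
  rw [← mul_zero (Real.Gamma (max α β - min α β) / (min α β * Real.Gamma α * Real.Gamma β))]
  exact h2.const_mul _

/-! ### Pairs of independent events -/

lemma measure_inter_inl_inr {κ Ω : Type*} [MeasurableSpace Ω] {μ : Measure Ω}
    {A : κ ⊕ κ → Set Ω} (hA : iIndepSet A μ) (r : κ) :
    μ (A (Sum.inl r) ∩ A (Sum.inr r)) = μ (A (Sum.inl r)) * μ (A (Sum.inr r)) := by
  have hset : A (Sum.inl r) ∩ A (Sum.inr r) =
      ⋂ l ∈ (Finset.disjSum {r} {r} : Finset (κ ⊕ κ)), A l := by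
    ext ω
    simp
  rw [hset, hA.meas_biInter, Finset.prod_disjSum, Finset.prod_singleton, Finset.prod_singleton]

lemma iIndepSet_inter_sum {κ Ω : Type*} [MeasurableSpace Ω] {μ : Measure Ω}
    {A : κ ⊕ κ → Set Ω} (hA : iIndepSet A μ) (hAm : ∀ l, MeasurableSet (A l)) :
    iIndepSet (fun r => A (Sum.inl r) ∩ A (Sum.inr r)) μ := by
  rw [iIndepSet_iff_meas_biInter fun r => (hAm _).inter (hAm _)]
  intro T
  have hset : ⋂ r ∈ T, (A (Sum.inl r) ∩ A (Sum.inr r)) = ⋂ l ∈ T.disjSum T, A l := by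
    ext ω
    simp only [mem_iInter, mem_inter_iff, Finset.mem_disjSum]
    grind
  rw [hset, hA.meas_biInter, Finset.prod_disjSum, ← Finset.prod_mul_distrib]
  exact Finset.prod_congr rfl fun r _ => (measure_inter_inl_inr hA r).symm

/-- Among independent events indexed by pairs, the probability that every pair has a member which
fails. -/
lemma measureReal_iInter_union_compl {κ Ω : Type*} [Fintype κ] [MeasurableSpace Ω] {μ : Measure Ω}
    [IsProbabilityMeasure μ] {A : κ ⊕ κ → Set Ω} (hA : iIndepSet A μ)
    (hAm : ∀ l, MeasurableSet (A l)) :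
    μ.real (⋂ r, (A (Sum.inl r))ᶜ ∪ (A (Sum.inr r))ᶜ) =
      ∏ r, (μ.real (A (Sum.inl r))ᶜ + μ.real (A (Sum.inr r))ᶜ -
        μ.real (A (Sum.inl r))ᶜ * μ.real (A (Sum.inr r))ᶜ) := by
  have hpair : ∀ r, μ.real (A (Sum.inl r) ∩ A (Sum.inr r)) =
      μ.real (A (Sum.inl r)) * μ.real (A (Sum.inr r)) := fun r => by
    simp only [measureReal_def, measure_inter_inl_inr hA r, ENNReal.toReal_mul]
  have h := (iIndepSet_iff _ _).1 (iIndepSet_inter_sum hA hAm) Finset.univ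
    (f := fun r => (A (Sum.inl r) ∩ A (Sum.inr r))ᶜ)
    fun r _ => (MeasurableSpace.measurableSet_generateFrom (mem_singleton _)).compl
  simp only [Finset.mem_univ, iInter_true] at h
  simp only [← compl_inter]
  rw [measureReal_def, h, ENNReal.toReal_prod]
  refine Finset.prod_congr rfl fun r _ => ?_
  rw [← measureReal_def, probReal_compl_eq_one_sub ((hAm _).inter (hAm _)), hpair,
    probReal_compl_eq_one_sub (hAm _), probReal_compl_eq_one_sub (hAm _)]
  ring

lemma isEquivalent_add_sub_mul {ι : Type*} {F : Filter ι} {u v u' v' : ι → ℝ}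
    (hu : u ~[F] u') (hv : v ~[F] v') (hu' : 0 ≤ᶠ[F] u') (hv' : 0 ≤ᶠ[F] v')
    (hv0 : Tendsto v' F (𝓝 0)) :
    (fun i => u i + v i - u i * v i) ~[F] fun i => u' i + v' i := by
  have hle : u' =O[F] fun i => u' i + v' i := by
    refine IsBigO.of_bound 1 ?_
    filter_upwards [hu', hv'] with i (h1 : 0 ≤ u' i) (h2 : 0 ≤ v' i)
    rw [Real.norm_of_nonneg h1, Real.norm_of_nonneg (by positivity)]
    linarith
  have hle' : v' =O[F] fun i => u' i + v' i := by
    refine IsBigO.of_bound 1 ?_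
    filter_upwards [hu', hv'] with i (h1 : 0 ≤ u' i) (h2 : 0 ≤ v' i)
    rw [Real.norm_of_nonneg h2, Real.norm_of_nonneg (by positivity)]
    linarith
  have hvo : v =o[F] fun _ => (1 : ℝ) := (isLittleO_one_iff ℝ).2 (hv.symm.tendsto_nhds hv0)
  have huv : (fun i => u i * v i) =o[F] fun i => u' i + v' i := by
    simpa using (hu.isBigO.trans hle).mul_isLittleO hvo
  have hsum := ((hu.isLittleO.trans_isBigO hle).add (hv.isLittleO.trans_isBigO hle')).sub huv
  refine hsum.congr_left fun i => ?_
  simp only [Pi.sub_apply]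
  ring

/-! ### The outage event -/

lemma SystemParams.powerMargin_pos (s : SystemParams) : 0 < s.powerMargin := by
  have h1 := s.responsivity_pos
  have h2 := s.slotDuration_pos
  have h3 := s.power_pos
  have h4 := s.noise_pos
  have h5 := s.threshold_pos
  unfold powerMargin
  positivity

lemma SystemParams.snr_eq (s : SystemParams) (ρ h : ℝ) :
    s.snr ρ h = s.threshold * (ρ * s.powerMargin * h) ^ 2 := by
  have h4 := s.noise_pos
  have h5 := s.threshold_pos
  have : (ρ * s.powerMargin * h) ^ 2 = (ρ * (s.responsivity * s.slotDuration * s.power) * h) ^ 2 /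
      (s.noise * s.threshold) := by
    rw [← Real.sq_sqrt (mul_pos h4 h5).le, powerMargin]
    ring
  rw [this, snr]
  field_simp

lemma SystemParams.snr_lt_threshold_iff (s : SystemParams) {ρ hbar : ℝ} (hρ : 0 < ρ)
    (hhbar : 0 < hbar) (h : ℝ) :
    s.snr ρ (hbar * h) < s.threshold ↔
      h ∈ Ioo (-(hbar * ρ * s.powerMargin)⁻¹) (hbar * ρ * s.powerMargin)⁻¹ := by
  have hc : 0 < hbar * ρ * s.powerMargin := mul_pos (mul_pos hhbar hρ) s.powerMargin_pos
  have e : ρ * s.powerMargin * (hbar * h) = hbar * ρ * s.powerMargin * h := by ring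
  rw [s.snr_eq, e, mul_lt_iff_lt_one_right s.threshold_pos, sq_lt_one_iff_abs_lt_one, abs_mul,
    abs_of_pos hc, mem_Ioo, ← abs_lt, inv_eq_one_div,
    lt_div_iff₀' hc]

/-- Select-max fails exactly when every relay has a link below the threshold. -/
lemma outageEvent_eq_iInter {N : ℕ} {Ω : Type*} {s : SystemParams} {ρ hbar : Link N → ℝ}
    {h : Link N → Ω → ℝ} {b : Ω → Fin N} (hb : IsSelectMax s ρ hbar h b) :
    outageEvent s ρ hbar h b =
      ⋂ r, {ω | linkSNR s ρ hbar h (Link.SR r) ω < s.threshold} ∪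
        {ω | linkSNR s ρ hbar h (Link.RD r) ω < s.threshold} := by
  ext ω
  simp only [outageEvent, mem_ofPred_eq, mem_iInter, mem_union, ← min_lt_iff]
  exact ⟨fun H r => (hb ω r).trans_lt H, fun H => H (b ω)⟩

lemma measureReal_outageEvent {N : ℕ} {Ω : Type*} [MeasurableSpace Ω] {μ : Measure Ω}
    [IsProbabilityMeasure μ] {α β hbar ρ : Link N → ℝ} (hhbar : ∀ l, 0 < hbar l)
    (hρ : ∀ l, 0 < ρ l) {h : Link N → Ω → ℝ} (h_meas : ∀ l, Measurable (h l))
    (h_law : ∀ l, μ.map (h l) = gammaGammaMeasure (α l) (β l)) (h_indep : iIndepFun h μ)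
    {s : SystemParams} {b : Ω → Fin N} (hb : IsSelectMax s ρ hbar h b) (p : Link N → ℝ)
    (hp : ∀ l, p l = (gammaGammaMeasure (α l) (β l)).real
      (Ioo (-(hbar l * ρ l * s.powerMargin)⁻¹) (hbar l * ρ l * s.powerMargin)⁻¹)) :
    μ.real (outageEvent s ρ hbar h b) =
      ∏ r, (p (Link.SR r) + p (Link.RD r) - p (Link.SR r) * p (Link.RD r)) := by
  set I : Link N → Set ℝ := fun l =>
    Ioo (-(hbar l * ρ l * s.powerMargin)⁻¹) (hbar l * ρ l * s.powerMargin)⁻¹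
  set A : Link N → Set Ω := fun l => h l ⁻¹' (I l)ᶜ
  have hAm : ∀ l, MeasurableSet (A l) := fun l => h_meas l measurableSet_Ioo.compl
  have hAc : ∀ l, (A l)ᶜ = {ω | linkSNR s ρ hbar h l ω < s.threshold} := fun l => by
    ext ω
    simp [A, I, linkSNR, s.snr_lt_threshold_iff (hρ l) (hhbar l)]
  have hA : iIndepSet A μ := (iIndepSet_iff_meas_biInter hAm).2 fun T =>
    h_indep.measure_inter_preimage_eq_mul T fun l _ => measurableSet_Ioo.compl
  have hpA : ∀ l, μ.real (A l)ᶜ = p l := fun l => by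
    rw [hp l, ← h_law l, map_measureReal_apply (h_meas l) measurableSet_Ioo]
    simp [A, I]
  rw [outageEvent_eq_iInter hb]
  simp only [← hAc]
  rw [measureReal_iInter_union_compl hA hAm]
  simp only [hpA]

end FSO

theorem theorem5 {N : ℕ} {Ω : Type*} [MeasurableSpace Ω] (μ : Measure Ω) [IsProbabilityMeasure μ]
    (α β hbar ρ : FSO.Link N → ℝ)
    (hα : ∀ l, 0 < α l) (hβ : ∀ l, 0 < β l)
    (hαβ : ∀ l, ∀ k : ℤ, α l - β l ≠ (k : ℝ))
    (hhbar : ∀ l, 0 < hbar l) (hρ : ∀ l, 0 < ρ l)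
    (h : FSO.Link N → Ω → ℝ) (h_meas : ∀ l, Measurable (h l))
    (h_law : ∀ l, μ.map (h l) = FSO.gammaGammaMeasure (α l) (β l))
    (h_indep : iIndepFun h μ)
    {ι : Type*} (F : Filter ι) (s : ι → FSO.SystemParams)
    (hs : Tendsto (fun i => (s i).powerMargin) F atTop)
    (b : ι → Ω → Fin N) (hb : ∀ i, FSO.IsSelectMax (s i) ρ hbar h (b i)) :
    (fun i => μ.real (FSO.outageEvent (s i) ρ hbar h (b i))) ~[F]
      (fun i => ∏ r : Fin N,
        (FSO.leadingTerm (α (FSO.Link.SR r)) (β (FSO.Link.SR r)) (hbar (FSO.Link.SR r))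
            (ρ (FSO.Link.SR r)) (s i).powerMargin +
          FSO.leadingTerm (α (FSO.Link.RD r)) (β (FSO.Link.RD r)) (hbar (FSO.Link.RD r))
            (ρ (FSO.Link.RD r)) (s i).powerMargin)) := by
  have hP : ∀ᶠ i in F, 0 < (s i).powerMargin := Eventually.of_forall fun i => (s i).powerMargin_pos
  have heq := fun l => (FSO.gammaGammaMeasure_isEquivalent_leadingTerm (hα l) (hβ l)
    (fun H => hαβ l 0 (by simp [H])) (hhbar l) (hρ l)).comp_tendsto hs
  have hnn := fun l => hP.mono fun i hi =>
    FSO.leadingTerm_nonneg (hα l) (hβ l) (hhbar l) (hρ l) hi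
  have h0 := fun l => (FSO.tendsto_leadingTerm_atTop (hα l) (hβ l) (hhbar l) (hρ l)).comp hs
  refine (IsEquivalent.finsetProd (s := Finset.univ) fun r _ =>
    FSO.isEquivalent_add_sub_mul (heq (FSO.Link.SR r)) (heq (FSO.Link.RD r))
      (hnn _) (hnn _) (h0 _)).congr_left ?_
  refine Eventually.of_forall fun i => ?_
  exact (FSO.measureReal_outageEvent hhbar hρ h_meas h_law h_indep (hb i) _ fun l => rfl).symm
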